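/- Let $S$ be a finite inverse semigroup. For $s\in S$ write $\operatorname{dom} s=ss^{-1}$ and $\operatorname{ran} s=s^{-1}s$, and call $t$ a restriction of $s$ if $t=fs$ for some idempotent $f$. Idempotents $e,f$ are isomorphic if $e=\operatorname{dom} s$ and $f=\operatorname{ran} s$ for some $s\in S$; for an idempotent $e$, $G_e=\{s\in S:\operatorname{dom} s=e=\operatorname{ran} s\}$ is the maximal subgroup at $e$. Elements $g\in G_e$ and $h\in G_f$ are conjugate in $S$ if there is $s\in S$ with $\operatorname{dom} s=e$, $\operatorname{ran} s=f$ and $g=shs^{-1}$. Let $e_1,\dots,e_n$ be representatives of the isomorphism classes of idempotents of $S$ (one for each class), and put $G_i=G_{e_i}$. For an irreducible complex character $\chi$ of $G_i$, afforded by a representation $\varphi$ on $V$, let $\chi^*$ be the character of the following representation $\varphi^*$ of $S$. Let $D_i$ be the set of idempotents isomorphic to $e_i$, and for each $f\in D_i$ fix $p_f\in S$ with $\operatorname{dom} p_f=e_i$, $\operatorname{ran} p_f=f$ (and $p_{e_i}=e_i$). Then $\varphi^*(s)$ acts on $V^{D_i}$ as the block matrix whose $(x,y)$ block, for $x,y\in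 D_i$, is $\sum_t\varphi(p_x t p_y^{-1})$, the sum being over the restrictions $t$ of $s$ with $\operatorname{dom} t=x$ and $\operatorname{ran} t=y$. Let $\mathsf C$ be the character table of $S$: its rows are indexed by $\biguplus_i \operatorname{Irr}(G_i)$, its columns by the disjoint union of the sets of conjugacy classes of the $G_j$, and $\mathsf C_{\chi,C}=\chi^*(g)$ for $g\in C$. Let $\mathsf Y=\operatorname{diag}(\mathsf X_1,\dots,\mathsf X_n)$, where $\mathsf X_i$ is the character table of $G_i$. For $g\in G_i$ let $C^i_g$ be the conjugacy class of $g$ in $G_i$. Then there is a unique complex matrix $\mathsf A$ with $\mathsf C=\mathsf Y\mathsf A$, and for all $i,j$, $h\in G_i$ and $g\in G_j$, the entry $\mathsf A_{C^i_h,\,C^j_g}$ is the number of restrictions of $g$ that are conjugate to $h$ in $S$. Moreover, if the $e_i$ are ordered so that $i\le j$ whenever $e_i$ is isomorphic to an idempotent that is a restriction of $e_j$, then $\mathsf A$ is block upper unitriangular (block upper triangular, with identity matrices as diagonal blocks). -/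

import Mathlib

/-- An inverse semigroup: every `s` has exactly one `t` with `s t s = s` and `t s t = t`;
this `t` is `s⁻¹`. -/
class InverseSemigroup (S : Type*) extends Semigroup S, Inv S where
  mul_inv_mul (s : S) : s * s⁻¹ * s = s
  inv_mul_inv (s : S) : s⁻¹ * s * s⁻¹ = s⁻¹
  eq_inv (s t : S) : s * t * s = s → t * s * t = t → t = s⁻¹

namespace InverseSemigroup

section Basic

variable {S : Type*} [InverseSemigroup S]

/-- The domain `s s⁻¹` of `s`. -/
def dom (s : S) : S := s * s⁻¹

/-- The range `s⁻¹ s` of `s`. -/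
def ran (s : S) : S := s⁻¹ * s

/-- The natural partial order: `s` is a restriction of `t` if `s = f t` with `f` idempotent. -/
def IsRestriction (s t : S) : Prop := ∃ f : S, IsIdempotentElem f ∧ s = f * t

/-- Isomorphic (that is, `𝒟`-equivalent) idempotents. -/
def Iso (e f : S) : Prop := ∃ s : S, dom s = e ∧ ran s = f

/-- The preorder on idempotents: `e ⪯ f` if `e` is isomorphic to an idempotent below `f`. -/
def Preceq (e f : S) : Prop := ∃ e' : S, IsIdempotentElem e' ∧ Iso e e' ∧ IsRestriction e' f

/-- `g` and `h` are conjugate in `S`: they lie in maximal subgroups `G_e` and `G_f`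
(so `e = dom g = ran g` and `f = dom h = ran h`), and `g = s h s⁻¹` for some `s` with
domain `e` and range `f`. -/
def Conjugate (g h : S) : Prop :=
  ∃ e f : S, (dom g = e ∧ ran g = e) ∧ (dom h = f ∧ ran h = f) ∧
    ∃ s : S, dom s = e ∧ ran s = f ∧ g = s * h * s⁻¹

theorem dom_mul (s : S) : dom s * s = s := mul_inv_mul s

theorem mul_ran (s : S) : s * ran s = s := by
  rw [ran, ← mul_assoc]; exact mul_inv_mul s

theorem ran_mul_inv (s : S) : ran s * s⁻¹ = s⁻¹ := inv_mul_inv s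

theorem inv_mul_dom (s : S) : s⁻¹ * dom s = s⁻¹ := by
  rw [dom, ← mul_assoc]; exact inv_mul_inv s

theorem inv_inv' (s : S) : (s⁻¹)⁻¹ = s :=
  (eq_inv s⁻¹ s (inv_mul_inv s) (mul_inv_mul s)).symm

theorem dom_inv (s : S) : dom s⁻¹ = ran s := by rw [dom, ran, inv_inv']

theorem ran_inv (s : S) : ran s⁻¹ = dom s := by rw [dom, ran, inv_inv']

theorem isIdempotentElem_dom (s : S) : IsIdempotentElem (dom s) := by
  show s * s⁻¹ * (s * s⁻¹) = s * s⁻¹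
  rw [← mul_assoc, mul_inv_mul]

theorem isIdempotentElem_ran (s : S) : IsIdempotentElem (ran s) := by
  rw [← dom_inv]; exact isIdempotentElem_dom _

theorem inv_of_idem {e : S} (he : IsIdempotentElem e) : e⁻¹ = e := by
  have h : e * e * e = e := by rw [he.eq, he.eq]
  exact (eq_inv e e h h).symm

theorem dom_of_idem {e : S} (he : IsIdempotentElem e) : dom e = e := by
  rw [dom, inv_of_idem he, he.eq]

theorem ran_of_idem {e : S} (he : IsIdempotentElem e) : ran e = e := by
  rw [ran, inv_of_idem he, he.eq]

theorem idem_mul {e f : S} (he : IsIdempotentElem e) (hf : IsIdempotentElem f) :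
    IsIdempotentElem (e * f) := by
  have e1 : ∀ a, e * (e * a) = e * a := fun a => by rw [← mul_assoc, he.eq]
  have f1 : ∀ a, f * (f * a) = f * a := fun a => by rw [← mul_assoc, hf.eq]
  obtain ⟨x, hx⟩ : ∃ x, x = (e * f)⁻¹ := ⟨_, rfl⟩
  have h1 : e * (f * (x * (e * f))) = e * f := by
    have := mul_inv_mul (e * f)
    rw [← hx] at this
    simpa only [mul_assoc] using this
  have h2 : x * (e * (f * x)) = x := by
    have := inv_mul_inv (e * f)
    rw [← hx] at this
    simpa only [mul_assoc] using this
  have h2' : ∀ a, x * (e * (f * (x * a))) = x * a := fun a => by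
    have := congrArg (· * a) h2
    simpa only [mul_assoc] using this
  have hx' : f * (x * e) = x := by
    rw [hx]
    refine eq_inv (e * f) _ ?_ ?_
    · rw [← hx]; simp only [mul_assoc, e1, f1]; exact h1
    · rw [← hx]; simp only [mul_assoc, e1, f1, h2']
  have hxi : IsIdempotentElem x := by
    show x * x = x
    conv_lhs => rw [← hx']
    simp only [mul_assoc, h2']
    exact hx'
  have : x⁻¹ = e * f := by rw [hx, inv_inv']
  rw [← this, inv_of_idem hxi]
  exact hxi

theorem idem_comm {e f : S} (he : IsIdempotentElem e) (hf : IsIdempotentElem f) :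
    e * f = f * e := by
  have e1 : ∀ a, e * (e * a) = e * a := fun a => by rw [← mul_assoc, he.eq]
  have f1 : ∀ a, f * (f * a) = f * a := fun a => by rw [← mul_assoc, hf.eq]
  have h1 := idem_mul he hf
  have h2 := idem_mul hf he
  have h1' : e * (f * (e * f)) = e * f := by simpa only [mul_assoc] using h1.eq
  have h2' : f * (e * (f * e)) = f * e := by simpa only [mul_assoc] using h2.eq
  have := eq_inv (e * f) (f * e) (by simp only [mul_assoc, e1, f1, h1'])
    (by simp only [mul_assoc, e1, f1, h2'])
  rw [this, inv_of_idem h1]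

theorem mul_inv' (s t : S) : (s * t)⁻¹ = t⁻¹ * s⁻¹ := by
  have hc := idem_comm (isIdempotentElem_dom t) (isIdempotentElem_ran s)
  symm
  apply eq_inv
  · calc s * t * (t⁻¹ * s⁻¹) * (s * t) = s * (dom t * ran s) * t := by
          simp only [dom, ran, mul_assoc]
      _ = (s * ran s) * (dom t * t) := by rw [hc]; simp only [mul_assoc]
      _ = s * t := by rw [mul_ran, dom_mul]
  · calc t⁻¹ * s⁻¹ * (s * t) * (t⁻¹ * s⁻¹) = t⁻¹ * (ran s * dom t) * s⁻¹ := by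
          simp only [dom, ran, mul_assoc]
      _ = (t⁻¹ * dom t) * (ran s * s⁻¹) := by rw [← hc]; simp only [mul_assoc]
      _ = t⁻¹ * s⁻¹ := by rw [inv_mul_dom, ran_mul_inv]

theorem dom_mul_of {s t : S} (h : ran s = dom t) : dom (s * t) = dom s := by
  calc s * t * (s * t)⁻¹ = s * dom t * s⁻¹ := by rw [mul_inv']; simp only [dom, mul_assoc]
    _ = dom s := by rw [← h, mul_ran, dom]

theorem ran_mul_of {s t : S} (h : ran s = dom t) : ran (s * t) = ran t := by
  calc (s * t)⁻¹ * (s * t) = t⁻¹ * (ran s * t) := by rw [mul_inv']; simp only [ran, mul_assoc]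
    _ = ran t := by rw [h, dom_mul, ran]

theorem IsRestriction.eq_dom_mul {s t : S} (h : IsRestriction s t) : s = dom s * t := by
  obtain ⟨f, hf, rfl⟩ := h
  have h1 : dom (f * t) = f * dom t := by
    calc f * t * (f * t)⁻¹ = f * (dom t * f) := by
          rw [mul_inv', inv_of_idem hf]; simp only [dom, mul_assoc]
      _ = f * dom t := by rw [idem_comm (isIdempotentElem_dom t) hf, ← mul_assoc, hf.eq]
  rw [h1, mul_assoc, dom_mul]

theorem IsRestriction.eq_mul_ran {s t : S} (h : IsRestriction s t) : s = t * ran s := by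
  obtain ⟨f, hf, rfl⟩ := h
  have h1 : ran (f * t) = t⁻¹ * f * t := by
    calc (f * t)⁻¹ * (f * t) = t⁻¹ * (f * f) * t := by
          rw [mul_inv', inv_of_idem hf]; simp only [mul_assoc]
      _ = t⁻¹ * f * t := by rw [hf.eq]
  calc f * t = f * (dom t * t) := by rw [dom_mul]
    _ = dom t * f * t := by rw [← mul_assoc, idem_comm hf (isIdempotentElem_dom t)]
    _ = t * ran (f * t) := by rw [h1]; simp only [dom, mul_assoc]

theorem conj_idem (s : S) {f : S} (hf : IsIdempotentElem f) :
    IsIdempotentElem (s * f * s⁻¹) := by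
  have h := isIdempotentElem_dom (s * f)
  have : dom (s * f) = s * f * s⁻¹ := by
    calc s * f * (s * f)⁻¹ = s * (f * f) * s⁻¹ := by
          rw [mul_inv', inv_of_idem hf]; simp only [mul_assoc]
      _ = _ := by rw [hf.eq]
  rwa [this] at h

/-- Restrictions multiply. -/
theorem IsRestriction.mul {s t s' t' : S} (hs : IsRestriction s' s) (ht : IsRestriction t' t) :
    IsRestriction (s' * t') (s * t) := by
  obtain ⟨f, hf, rfl⟩ := hs
  obtain ⟨k, hk, rfl⟩ := ht
  refine ⟨f * (s * k * s⁻¹), idem_mul hf (conj_idem s hk), ?_⟩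
  calc f * s * (k * t) = f * (s * ran s * k * t) := by rw [mul_ran]; simp only [mul_assoc]
    _ = f * (s * (k * ran s) * t) := by
        rw [mul_assoc s, idem_comm (isIdempotentElem_ran s) hk]
    _ = _ := by simp only [ran, mul_assoc]

end Basic

/-- The type of idempotents of `S`. -/
abbrev Idem (S : Type*) [InverseSemigroup S] : Type _ := {e : S // IsIdempotentElem e}

/-- The maximal subgroup `G_e` at the idempotent `e`: the elements with domain and range `e`. -/
def MaxSubgroup {S : Type*} [InverseSemigroup S] (e : Idem S) : Type _ :=
  {s : S // dom s = e ∧ ran s = e}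

section MaxSubgroup

variable {S : Type*} [InverseSemigroup S] {e : Idem S}

/-- Multiplication and inversion are those of `S`, the identity is `e`. -/
instance : Group (MaxSubgroup e) where
  mul a b := ⟨a.1 * b.1, by
    have h : ran a.1 = dom b.1 := a.2.2.trans b.2.1.symm
    exact ⟨(dom_mul_of h).trans a.2.1, (ran_mul_of h).trans b.2.2⟩⟩
  one := ⟨e.1, dom_of_idem e.2, ran_of_idem e.2⟩
  inv a := ⟨a.1⁻¹, (dom_inv a.1).trans a.2.2, (ran_inv a.1).trans a.2.1⟩
  mul_assoc a b c := Subtype.ext (mul_assoc a.1 b.1 c.1)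
  one_mul a := Subtype.ext (by
    have h := dom_mul a.1
    rw [a.2.1] at h
    exact h)
  mul_one a := Subtype.ext (by
    have h := mul_ran a.1
    rw [a.2.2] at h
    exact h)
  inv_mul_cancel a := Subtype.ext a.2.2

instance [Finite S] : Finite (MaxSubgroup e) :=
  inferInstanceAs (Finite {s : S // dom s = e ∧ ran s = e})

theorem MaxSubgroup.val_mul (a b : MaxSubgroup e) : (a * b).1 = a.1 * b.1 := rfl

end MaxSubgroup

/-- The idempotents isomorphic to `e`, i.e. the idempotents of the `𝒟`-class of `e`. -/
def IsoIdem {S : Type*} [InverseSemigroup S] (e : Idem S) : Type _ :=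
  {f : S // IsIdempotentElem f ∧ Iso e.1 f}

noncomputable section

section Induction

variable {S : Type*} [InverseSemigroup S] [Finite S] (e : Idem S)

instance : Finite (IsoIdem e) :=
  inferInstanceAs (Finite {f : S // IsIdempotentElem f ∧ Iso e.1 f})

instance : Fintype (IsoIdem e) := Fintype.ofFinite _

open Classical in
/-- A fixed choice, for each idempotent `f` isomorphic to `e`, of an element `p_f` with domain
`e` and range `f`, where `p_e = e`. -/
def transporter {S : Type*} [InverseSemigroup S] (e : Idem S) (f : IsoIdem e) : S :=
  if f.1 = e.1 then e.1 else f.2.2.choose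

theorem transporter_spec {S : Type*} [InverseSemigroup S] (e : Idem S) (f : IsoIdem e) :
    dom (transporter e f) = e.1 ∧ ran (transporter e f) = f.1 := by
  unfold transporter
  split_ifs with h
  · exact ⟨dom_of_idem e.2, (ran_of_idem e.2).trans h.symm⟩
  · exact f.2.2.choose_spec

/-- The restrictions of `s` with domain `x` and range `y`. -/
def RestrictionFromTo {S : Type*} [InverseSemigroup S] {e : Idem S} (s : S) (x y : IsoIdem e) :
    Type _ :=
  {t : S // IsRestriction t s ∧ dom t = x.1 ∧ ran t = y.1}

instance {e : Idem S} (s : S) (x y : IsoIdem e) : Fintype (RestrictionFromTo s x y) :=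
  @Fintype.ofFinite _
    (inferInstanceAs (Finite {t : S // IsRestriction t s ∧ dom t = x.1 ∧ ran t = y.1}))

/-- For `t` with domain `x` and range `y` in the `𝒟`-class of `e`, the element
`p_x t p_y⁻¹` of `G_e`. -/
def toMaxSubgroup {S : Type*} [InverseSemigroup S] {e : Idem S} {s : S} {x y : IsoIdem e}
    (t : RestrictionFromTo s x y) : MaxSubgroup e :=
  ⟨transporter e x * t.1 * (transporter e y)⁻¹, by
    obtain ⟨hx1, hx2⟩ := transporter_spec e x
    obtain ⟨hy1, hy2⟩ := transporter_spec e y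
    obtain ⟨_, ht1, ht2⟩ := t.2
    have h1 : ran (transporter e x) = dom t.1 := hx2.trans ht1.symm
    have h2 : ran (transporter e x * t.1) = dom (transporter e y)⁻¹ := by
      rw [ran_mul_of h1, dom_inv, ht2, hy2]
    rw [dom_mul_of h2, ran_mul_of h2, dom_mul_of h1, ran_inv]
    exact ⟨hx1, hy1⟩⟩

/-- The matrix over `ℂ G_e` assigned to `s`. In the groupoid basis one has
`s = ∑_{t ≤ s} ⌊t⌋`; here `⌊t⌋` goes to `p_x t p_y⁻¹ E_{x,y}` if `t` has domain `x` and range `y`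
in the `𝒟`-class of `e`, and to `0` if `t` lies in another `𝒟`-class. -/
def munnMatrix (s : S) : Matrix (IsoIdem e) (IsoIdem e) (MonoidAlgebra ℂ (MaxSubgroup e)) :=
  fun x y => ∑ t : RestrictionFromTo s x y, MonoidAlgebra.of ℂ (MaxSubgroup e) (toMaxSubgroup t)

theorem munnMatrix_mul (s t : S) : munnMatrix e (s * t) = munnMatrix e s * munnMatrix e t := by
  classical
  ext1 x z
  rw [Matrix.mul_apply]
  simp only [munnMatrix, Finset.sum_mul_sum, ← map_mul]
  simp only [← Fintype.sum_prod_type', ← Fintype.sum_sigma']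
  symm
  have key : ∀ q : Σ y, RestrictionFromTo s x y × RestrictionFromTo t y z,
      IsRestriction (q.2.1.1 * q.2.2.1) (s * t) ∧ dom (q.2.1.1 * q.2.2.1) = x.1 ∧
        ran (q.2.1.1 * q.2.2.1) = z.1 := by
    rintro ⟨y, a, b⟩
    have h : ran a.1 = dom b.1 := a.2.2.2.trans b.2.2.1.symm
    exact ⟨a.2.1.mul b.2.1, (dom_mul_of h).trans a.2.2.1, (ran_mul_of h).trans b.2.2.2⟩
  let F : (Σ y, RestrictionFromTo s x y × RestrictionFromTo t y z) →
      RestrictionFromTo (s * t) x z := fun q => ⟨q.2.1.1 * q.2.2.1, key q⟩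
  refine Fintype.sum_bijective F ⟨?_, ?_⟩ _ _ ?_
  · rintro ⟨y, a, b⟩ ⟨y', a', b'⟩ -
    have ha : a.1 = a'.1 := by
      rw [a.2.1.eq_dom_mul, a'.2.1.eq_dom_mul, a.2.2.1, a'.2.2.1]
    have hb : b.1 = b'.1 := by
      rw [b.2.1.eq_mul_ran, b'.2.1.eq_mul_ran, b.2.2.2, b'.2.2.2]
    have hy : y = y' := Subtype.ext (by rw [← a.2.2.2, ← a'.2.2.2, ha])
    subst hy
    have ha' : a = a' := Subtype.ext ha
    have hb' : b = b' := Subtype.ext hb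
    rw [ha', hb']
  · rintro ⟨u, hu, hux, huz⟩
    have e1 : u = dom u * (s * t) := hu.eq_dom_mul
    have e2 : u = s * t * ran u := hu.eq_mul_ran
    -- the factors are `s' = (u u⁻¹) s` and `t' = t (u⁻¹ u)`
    have i1 : (dom u * s)⁻¹ = t * u⁻¹ := by
      symm
      apply eq_inv
      · calc dom u * s * (t * u⁻¹) * (dom u * s) = dom u * (s * t) * (u⁻¹ * dom u) * s := by
              simp only [mul_assoc]
          _ = dom u * s := by rw [← e1, inv_mul_dom]; rfl
      · calc t * u⁻¹ * (dom u * s) * (t * u⁻¹) = t * u⁻¹ * (dom u * (s * t)) * u⁻¹ := by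
              simp only [mul_assoc]
          _ = t * (u⁻¹ * u * u⁻¹) := by rw [← e1]; simp only [mul_assoc]
          _ = t * u⁻¹ := by rw [inv_mul_inv]
    have i2 : (t * ran u)⁻¹ = u⁻¹ * s := by
      symm
      apply eq_inv
      · calc t * ran u * (u⁻¹ * s) * (t * ran u) = t * (ran u * u⁻¹) * (s * t * ran u) := by
              simp only [mul_assoc]
          _ = t * (u⁻¹ * u) := by rw [← e2, ran_mul_inv, mul_assoc]
          _ = t * ran u := rfl
      · calc u⁻¹ * s * (t * ran u) * (u⁻¹ * s) = u⁻¹ * (s * t * ran u) * u⁻¹ * s := by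
              simp only [mul_assoc]
          _ = u⁻¹ * s := by rw [← e2, inv_mul_inv]
    have hd1 : dom (dom u * s) = dom u := by
      calc dom u * s * (dom u * s)⁻¹ = dom u * (s * t) * u⁻¹ := by
            rw [i1]; simp only [mul_assoc]
        _ = dom u := by rw [← e1]; rfl
    have hr2 : ran (t * ran u) = ran u := by
      calc (t * ran u)⁻¹ * (t * ran u) = u⁻¹ * (s * t * ran u) := by
            rw [i2]; simp only [mul_assoc]
        _ = ran u := by rw [← e2]; rfl
    have hm : ran (dom u * s) = dom (t * ran u) := by
      show (dom u * s)⁻¹ * (dom u * s) = t * ran u * (t * ran u)⁻¹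
      rw [i1, i2]
      calc t * u⁻¹ * (dom u * s) = t * (u⁻¹ * dom u) * s := by simp only [mul_assoc]
        _ = t * (ran u * u⁻¹) * s := by rw [inv_mul_dom, ran_mul_inv]
        _ = t * ran u * (u⁻¹ * s) := by simp only [mul_assoc]
    have hst : dom u * s * (t * ran u) = u := by
      calc dom u * s * (t * ran u) = dom u * (s * t) * ran u := by simp only [mul_assoc]
        _ = u := by rw [← e1, mul_ran]
    have hres : IsRestriction (t * ran u) t := by
      refine ⟨t * ran u * t⁻¹, conj_idem t (isIdempotentElem_ran u), ?_⟩
      calc t * ran u = t * (ran t * ran u) := by rw [← mul_assoc, mul_ran]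
        _ = t * (ran u * ran t) := by
            rw [idem_comm (isIdempotentElem_ran t) (isIdempotentElem_ran u)]
        _ = t * ran u * t⁻¹ * t := by simp only [ran, mul_assoc]
    have hiso : Iso e.1 (ran (dom u * s)) := by
      obtain ⟨hx1, hx2⟩ := transporter_spec e x
      have h : ran (transporter e x) = dom (dom u * s) := by rw [hd1, hux, hx2]
      exact ⟨transporter e x * (dom u * s), (dom_mul_of h).trans hx1, ran_mul_of h⟩
    refine ⟨⟨⟨ran (dom u * s), isIdempotentElem_ran _, hiso⟩,
      ⟨dom u * s, ⟨dom u, isIdempotentElem_dom u, rfl⟩, hd1.trans hux, rfl⟩,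
      ⟨t * ran u, hres, hm.symm, hr2.trans huz⟩⟩, Subtype.ext hst⟩
  · rintro ⟨y, a, b⟩
    congr 1
    apply Subtype.ext
    show transporter e x * a.1 * (transporter e y)⁻¹ * (transporter e y * b.1 * (transporter e z)⁻¹)
      = transporter e x * (a.1 * b.1) * (transporter e z)⁻¹
    have hy : (transporter e y)⁻¹ * transporter e y = ran a.1 :=
      (transporter_spec e y).2.trans a.2.2.2.symm
    calc _ = transporter e x * a.1 * ((transporter e y)⁻¹ * transporter e y) * b.1
          * (transporter e z)⁻¹ := by simp only [mul_assoc]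
      _ = transporter e x * (a.1 * ran a.1) * b.1 * (transporter e z)⁻¹ := by
          rw [hy]; simp only [mul_assoc]
      _ = _ := by rw [mul_ran]; simp only [mul_assoc]

/-- The homomorphism from `S` to matrices over `ℂ G_e` (the projection of `ℂ S` onto the summand
of the `𝒟`-class of `e`, restricted to `S`). -/
def munnHom : S →ₙ* Matrix (IsoIdem e) (IsoIdem e) (MonoidAlgebra ℂ (MaxSubgroup e)) where
  toFun := munnMatrix e
  map_mul' := munnMatrix_mul e

end Induction

section Matrices

variable {G : Type*} [Group G] {V : Type*} [AddCommGroup V] [Module ℂ V]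

/-- The action of `m × m` matrices over `ℂ G` on `V^m`, for a representation of `G` on `V`. -/
def matrixAction (m : Type*) [Fintype m] (φ : Representation ℂ G V) :
    Matrix m m (MonoidAlgebra ℂ G) →ₙ* Module.End ℂ (m → V) where
  toFun M := LinearMap.pi fun x => ∑ y, φ.asAlgebraHom (M x y) ∘ₗ LinearMap.proj y
  map_mul' M N := by
    ext1 v
    funext x
    simp only [LinearMap.pi_apply, LinearMap.sum_apply, LinearMap.comp_apply, LinearMap.proj_apply,
      Module.End.mul_apply, Matrix.mul_apply, map_sum, map_mul]
    exact Finset.sum_comm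

end Matrices

/-- The irreducible complex characters of `G`. -/
def IrrChar (G : Type*) [Group G] : Type _ :=
  {χ : G → ℂ // ∃ (d : ℕ) (φ : Representation ℂ G (Fin d → ℂ)),
    φ.IsIrreducible ∧ φ.character = χ}

section Group

variable {G : Type*} [Group G]

/-- The degree of an irreducible character. -/
def IrrChar.degree (χ : IrrChar G) : ℕ := χ.2.choose

/-- A representation affording the irreducible character `χ`. -/
def IrrChar.rep (χ : IrrChar G) : Representation ℂ G (Fin χ.degree → ℂ) := χ.2.choose_spec.choose

theorem IrrChar.rep_spec (χ : IrrChar G) : χ.rep.IsIrreducible ∧ χ.rep.character = χ.1 :=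
  χ.2.choose_spec.choose_spec

/-- The character table of a group: rows are the irreducible characters and columns the conjugacy
classes. -/
def groupCharTable (G : Type*) [Group G] : Matrix (IrrChar G) (ConjClasses G) ℂ :=
  fun χ c => Quotient.lift χ.1 (by
    rintro a b (hab : IsConj a b)
    obtain ⟨c, rfl⟩ := isConj_iff.1 hab
    obtain ⟨d, φ, -, hφ⟩ := χ.2
    rw [← hφ, Representation.char_conj]) c

end Group

section CharTable

variable {S : Type*} [InverseSemigroup S] [Finite S]

/-- The representation `φ*` of `S` induced by a representation `φ` of `G_e`. -/
def starRep (e : Idem S) {V : Type*} [AddCommGroup V] [Module ℂ V]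
    (φ : Representation ℂ (MaxSubgroup e) V) : S →ₙ* Module.End ℂ (IsoIdem e → V) :=
  (matrixAction (IsoIdem e) φ).comp (munnHom e)

/-- The character `χ*` of `S` induced by an irreducible character `χ` of `G_e`: the trace of
`φ*`, where `φ` affords `χ`. -/
def starChar {e : Idem S} (χ : IrrChar (MaxSubgroup e)) (s : S) : ℂ :=
  LinearMap.trace ℂ (IsoIdem e → Fin χ.degree → ℂ) (starRep e χ.rep s)

theorem starChar_conj {e f : Idem S} (χ : IrrChar (MaxSubgroup e)) {g h : MaxSubgroup f}
    (hgh : IsConj g h) : starChar χ g.1 = starChar χ h.1 := by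
  obtain ⟨c, rfl⟩ := isConj_iff.1 hgh
  have h1 : g.1 = (g * c⁻¹).1 * c.1 := by rw [← MaxSubgroup.val_mul, inv_mul_cancel_right]
  have h2 : (c * g * c⁻¹).1 = c.1 * (g * c⁻¹).1 := by rw [← MaxSubgroup.val_mul, mul_assoc]
  rw [h2, h1]
  simp only [starChar, map_mul]
  exact LinearMap.trace_mul_comm ℂ _ _

variable {n : ℕ}

/-- The labels of the rows: the disjoint union of the sets of irreducible characters of the
`G_{e_i}`. -/
abbrev RowIndex (e : Fin n → Idem S) : Type _ := Σ i, IrrChar (MaxSubgroup (e i))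

/-- The labels of the columns: the disjoint union of the sets of conjugacy classes of the
`G_{e_i}`. -/
abbrev ColIndex (e : Fin n → Idem S) : Type _ := Σ i, ConjClasses (MaxSubgroup (e i))

instance (e : Fin n → Idem S) : Fintype (ColIndex e) :=
  @Fintype.ofFinite _ inferInstance

/-- `e_1, …, e_n` represent the isomorphism classes of idempotents of `S`, each exactly once. -/
def IsTransversal (e : Fin n → Idem S) : Prop := ∀ f : Idem S, ∃! i, Iso (e i).1 f.1

/-- The character table `C` of `S`: the entry at `χ ∈ Irr(G_{e_i})` and the conjugacy class of
`g ∈ G_{e_j}` is `χ*(g)`. -/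
def charTable (e : Fin n → Idem S) : Matrix (RowIndex e) (ColIndex e) ℂ :=
  fun χ c => Quotient.lift (fun g : MaxSubgroup (e c.1) => starChar χ.2 g.1)
    (fun _ _ h => starChar_conj χ.2 h) c.2

/-- The block diagonal matrix `Y` of the character tables of the groups `G_{e_i}`. -/
def blockCharTable (e : Fin n → Idem S) : Matrix (RowIndex e) (ColIndex e) ℂ :=
  Matrix.blockDiagonal' fun i => groupCharTable (MaxSubgroup (e i))

/-- Block upper triangular with identity matrices as diagonal blocks. -/
def IsBlockUpperUnitriangular (e : Fin n → Idem S) (A : Matrix (ColIndex e) (ColIndex e) ℂ) :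
    Prop :=
  A.BlockTriangular Sigma.fst ∧
    (∀ i (c : ConjClasses (MaxSubgroup (e i))), A ⟨i, c⟩ ⟨i, c⟩ = 1) ∧
    ∀ i (c d : ConjClasses (MaxSubgroup (e i))), c ≠ d → A ⟨i, c⟩ ⟨i, d⟩ = 0

end CharTable

end

end InverseSemigroup

/-! The trace of `φ*(s)` only sees the diagonal blocks, so `χ*(s)` is the sum of `χ (p_x t p_x⁻¹)`
over all restrictions `t` of `s` with equal domain and range `x`, where `x` is isomorphic to `e`
(`starChar_eq_sum`). The element `p_x t p_x⁻¹` lies in the class of `h` exactly when `t` is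
conjugate to `h` in `S`. Collecting terms by classes therefore writes `χ*(s)` as the product of the
row of `χ` in the group character table with the vector of restriction counts
(`starChar_eq_mulVec`). This is `C = Y A` read one column at a time.

Uniqueness reduces, block by block, to the independence of the columns of each group character table
(`eq_zero_of_groupCharTable_mulVec`). This follows from Maschke's theorem and Schur's lemma: a
central element of `ℂ G` with all irreducible traces zero vanishes.

For the triangular shape, a restriction of `g ∈ G_f` conjugate to an element of `G_e` has its domain
below `f` and isomorphic to `e`. If `e = f`, finiteness forces that domain to be `e`
(`IsRestriction.eq_of_iso`), so the restriction is `g` itself. -/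

noncomputable section

namespace InverseSemigroup

/-! ### Independence of the columns of a group character table -/

section GroupCharTable

variable {G : Type*} [Group G]

/-- The representation on `W` transported from a module over the group algebra. -/
def repOfModule {N : Type*} [AddCommGroup N] [Module ℂ N] [Module (MonoidAlgebra ℂ G) N]
    [IsScalarTower ℂ (MonoidAlgebra ℂ G) N] {W : Type*} [AddCommGroup W] [Module ℂ W]
    (b : N ≃ₗ[ℂ] W) : Representation ℂ G W :=
  (((b.conjAlgEquiv ℂ).toAlgHom.comp (Algebra.lsmul ℂ ℂ N)).toMonoidHom).comp
    (MonoidAlgebra.of ℂ G)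

section repOfModule

variable {N : Type*} [AddCommGroup N] [Module ℂ N] [Module (MonoidAlgebra ℂ G) N]
  [IsScalarTower ℂ (MonoidAlgebra ℂ G) N] {W : Type*} [AddCommGroup W] [Module ℂ W]
  (b : N ≃ₗ[ℂ] W)

theorem repOfModule_asAlgebraHom :
    (repOfModule (G := G) b).asAlgebraHom =
      (b.conjAlgEquiv ℂ).toAlgHom.comp (Algebra.lsmul ℂ ℂ N) := by
  apply MonoidAlgebra.algHom_ext
  · intro g
    rw [Representation.asAlgebraHom_single_one]
    rfl
  · exact Subsingleton.elim _ _

/-- The transported representation is isomorphic to the original module. -/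
def repOfModuleEquiv : N ≃ₗ[MonoidAlgebra ℂ G] (repOfModule (G := G) b).asModule :=
  { b with
    map_smul' := fun x n => by
      change b (x • n) = (repOfModule (G := G) b).asAlgebraHom x (b n)
      rw [repOfModule_asAlgebraHom]
      simp [LinearEquiv.conjAlgEquiv_apply] }

theorem repOfModule_isIrreducible [IsSimpleModule (MonoidAlgebra ℂ G) N] :
    (repOfModule (G := G) b).IsIrreducible := by
  rw [Representation.irreducible_iff_isSimpleModule_asModule]
  exact IsSimpleModule.congr (repOfModuleEquiv b).symm

end repOfModule

/-- A central element of the group algebra on which all irreducible representations have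
trace `0` is `0`. -/
theorem eq_zero_of_trace_eq_zero [Finite G] (z : MonoidAlgebra ℂ G)
    (hz : ∀ x, x * z = z * x)
    (h : ∀ (d : ℕ) (φ : Representation ℂ G (Fin d → ℂ)), φ.IsIrreducible →
      LinearMap.trace ℂ _ (φ.asAlgebraHom z) = 0) : z = 0 := by
  have : Fintype G := Fintype.ofFinite G
  -- This is the hypothesis of Maschke's theorem: `ℂ G` is semisimple, hence the sum of its simple
  -- left ideals.
  have : NeZero (Nat.card G : ℂ) := ⟨by simp⟩
  suffices hk : LinearMap.ker (LinearMap.toSpanSingleton (MonoidAlgebra ℂ G) _ z) = ⊤ by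
    have h1 : (1 : MonoidAlgebra ℂ G) ∈
        LinearMap.ker (LinearMap.toSpanSingleton (MonoidAlgebra ℂ G) _ z) := hk ▸ trivial
    simpa using h1
  rw [eq_top_iff, ← IsSemisimpleModule.sSup_simples_eq_top (MonoidAlgebra ℂ G) (MonoidAlgebra ℂ G)]
  refine sSup_le fun N hN n hn => ?_
  have hN : IsSimpleModule (MonoidAlgebra ℂ G) N := hN
  have : Module.Finite ℂ N := Module.Finite.of_injective
    (N.subtype.restrictScalars ℂ) N.injective_subtype
  -- The hypothesis `h` concerns only representations on `Fin d → ℂ`, so the left ideal `N` is moved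
  -- there by a basis.
  let b := (Module.finBasis ℂ N).equivFun
  have ht := h _ _ (repOfModule_isIrreducible (G := G) b)
  -- Since `z` is central, its action on `N` is `ℂ G`-linear. By Schur it is a scalar `c`, and the
  -- trace `c * dim N` vanishes only if `c = 0`.
  let T : Module.End (MonoidAlgebra ℂ G) N :=
    { toFun := fun m => z • m
      map_add' := fun _ _ => smul_add _ _ _
      map_smul' := fun x m => by rw [RingHom.id_apply, ← mul_smul, ← mul_smul, hz] }
  obtain ⟨c, hc⟩ := (IsSimpleModule.algebraMap_end_bijective_of_isAlgClosed
    (A := MonoidAlgebra ℂ G) (V := N) ℂ).2 T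
  have hc' : Algebra.lsmul ℂ ℂ N z = c • 1 := by
    ext1 m
    exact (congrArg (fun f : Module.End (MonoidAlgebra ℂ G) N => f m) hc).symm
  rw [repOfModule_asAlgebraHom] at ht
  have ht' : LinearMap.trace ℂ N (Algebra.lsmul ℂ ℂ N z) = 0 := by
    rw [← ht]
    exact (LinearMap.trace_conj' _ b).symm
  have : Nontrivial N := IsSimpleModule.nontrivial (MonoidAlgebra ℂ G) N
  rw [hc', map_smul, LinearMap.trace_one, smul_eq_mul, mul_eq_zero] at ht'
  have hc0 : c = 0 := ht'.resolve_right (by simpa using Module.finrank_pos.ne')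
  have : z • (⟨n, hn⟩ : N) = 0 := by
    have := congrArg (fun f : Module.End ℂ N => f ⟨n, hn⟩) hc'
    simpa [hc0] using this
  have h2 : z * n = 0 := congrArg Subtype.val this
  rw [LinearMap.mem_ker, LinearMap.toSpanSingleton_apply, smul_eq_mul, hz, h2]

/-- The columns of the character table of a finite group are linearly independent. -/
theorem eq_zero_of_groupCharTable_mulVec [Finite G] [Fintype (ConjClasses G)]
    (a : ConjClasses G → ℂ) (h : Matrix.mulVec (groupCharTable G) a = 0) : a = 0 := by
  classical
  have : Fintype G := Fintype.ofFinite G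
  let m : ConjClasses G → ℂ := fun c => (Finset.univ.filter fun g : G => ConjClasses.mk g = c).card
  have hm : ∀ c, m c ≠ 0 := by
    intro c
    obtain ⟨g, rfl⟩ := ConjClasses.mk_surjective c
    exact Nat.cast_ne_zero.2 (Finset.card_ne_zero_of_mem (a := g) (by simp))
  -- Dividing by the class size makes each class `c` contribute `a c * χ c` to the trace of `∑ b(g)
  -- g`; being a class function makes that sum central.
  let b : G → ℂ := fun g => a (ConjClasses.mk g) / m (ConjClasses.mk g)
  have hconj : ∀ g x : G, b (x * g * x⁻¹) = b g := fun g x => by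
    have : ConjClasses.mk (x * g * x⁻¹) = ConjClasses.mk g :=
      ConjClasses.mk_eq_mk_iff_isConj.2 (isConj_iff.2 ⟨x, rfl⟩).symm
    simp only [b, this]
  let z : MonoidAlgebra ℂ G := ∑ g, MonoidAlgebra.single g (b g)
  have hz0 : z = 0 := by
    apply eq_zero_of_trace_eq_zero
    · intro x
      induction x using MonoidAlgebra.induction_linear with
      | zero => simp
      | add f g hf hg => rw [add_mul, mul_add, hf, hg]
      | single x r =>
        simp only [z, Finset.mul_sum, Finset.sum_mul, MonoidAlgebra.single_mul_single]
        refine Fintype.sum_equiv (MulAut.conj x).toEquiv _ _ fun g => ?_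
        simp [hconj, mul_comm]
    · intro d φ hφ
      let χ : IrrChar G := ⟨φ.character, d, φ, hφ, rfl⟩
      have hχ := congrFun h χ
      simp only [Matrix.mulVec, dotProduct, Pi.zero_apply] at hχ
      rw [← hχ]
      simp only [z, map_sum, Representation.asAlgebraHom_single, map_smul, smul_eq_mul]
      rw [← Finset.sum_fiberwise_of_maps_to (s := Finset.univ) (t := Finset.univ)
        (g := ConjClasses.mk) (fun _ _ => Finset.mem_univ _)]
      refine Finset.sum_congr rfl fun c _ => ?_
      have : ∀ g ∈ Finset.univ.filter (fun g : G => ConjClasses.mk g = c),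
          b g * LinearMap.trace ℂ _ (φ g) = a c / m c * groupCharTable G χ c := by
        intro g hg
        obtain rfl := (Finset.mem_filter.1 hg).2
        rfl
      rw [Finset.sum_congr rfl this, Finset.sum_const, nsmul_eq_mul]
      change m c * _ = _
      field_simp [hm c]
  funext c
  obtain ⟨g, rfl⟩ := ConjClasses.mk_surjective c
  have hb : b g = 0 := by
    have := congrArg (fun f : MonoidAlgebra ℂ G => f.coeff g) hz0
    simpa [z, Finsupp.single_apply] using this
  exact (div_eq_zero_iff.1 hb).resolve_right (hm _)

end GroupCharTable

/-! ### The character `χ*` as a sum over restrictions -/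

section Trace

theorem trace_matrixAction {G : Type*} [Group G] {d : ℕ} (m : Type*) [Fintype m]
    (φ : Representation ℂ G (Fin d → ℂ)) (M : Matrix m m (MonoidAlgebra ℂ G)) :
    LinearMap.trace ℂ _ (matrixAction m φ M) =
      ∑ x, LinearMap.trace ℂ _ (φ.asAlgebraHom (M x x)) := by
  classical
  rw [LinearMap.trace_eq_matrix_trace ℂ (Pi.basis fun _ : m => Pi.basisFun ℂ (Fin d)),
    Matrix.trace, Fintype.sum_sigma]
  refine Finset.sum_congr rfl fun x _ => ?_
  rw [LinearMap.trace_eq_matrix_trace ℂ (Pi.basisFun ℂ (Fin d)), Matrix.trace]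
  refine Finset.sum_congr rfl fun k _ => ?_
  simp only [Matrix.diag_apply, LinearMap.toMatrix_apply, Pi.basis_apply, Pi.basis_repr]
  change (∑ y, φ.asAlgebraHom (M x y) ∘ₗ LinearMap.proj y) _ k = φ.asAlgebraHom (M x x) _ k
  rw [LinearMap.sum_apply, Finset.sum_eq_single x]
  · simp
  · intro y _ hy
    simp [hy]
  · simp

variable {S : Type*} [InverseSemigroup S] [Finite S]

theorem starChar_eq_sum {e : Idem S} (χ : IrrChar (MaxSubgroup e)) (s : S) :
    starChar χ s = ∑ x : IsoIdem e, ∑ t : RestrictionFromTo s x x, χ.1 (toMaxSubgroup t) := by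
  refine (trace_matrixAction _ χ.rep (munnMatrix e s)).trans ?_
  simp only [munnMatrix, map_sum, Representation.asAlgebraHom_of]
  rw [← χ.rep_spec.2]
  rfl

end Trace

/-! ### Grouping restrictions by conjugacy class -/

section Count

variable {S : Type*} [InverseSemigroup S]

/-- The transporter `p_x` carries `G_x` to `G_e`: an element `u` from `x` to `e` conjugating `h` to
`t` corresponds to the element `p_x u` of `G_e`, with inverse correspondence `c ↦ p_x⁻¹ c`. -/
theorem conjugate_iff_isConj_toMaxSubgroup {e : Idem S} {s : S} {x : IsoIdem e}
    (t : RestrictionFromTo s x x) (h : MaxSubgroup e) :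
    Conjugate t.1 h.1 ↔ IsConj (toMaxSubgroup t) h := by
  obtain ⟨hp1, hp2⟩ := transporter_spec e x
  obtain ⟨t, htr, htd, htr'⟩ := t
  constructor
  · rintro ⟨a, b, ⟨hta, -⟩, ⟨hhb, -⟩, u, hu1, hu2, rfl⟩
    have hm : ran (transporter e x) = dom u := by rw [hp2, hu1, ← hta, htd]
    let c : MaxSubgroup e := ⟨transporter e x * u, by
      rw [dom_mul_of hm, ran_mul_of hm, hp1, hu2, ← hhb, h.2.1]; exact ⟨rfl, rfl⟩⟩
    refine (isConj_iff.2 ⟨c, ?_⟩).symm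
    apply Subtype.ext
    change transporter e x * u * h.1 * (transporter e x * u)⁻¹ =
      transporter e x * (u * h.1 * u⁻¹) * (transporter e x)⁻¹
    rw [mul_inv']
    simp only [mul_assoc]
  · intro hc
    obtain ⟨c, hc⟩ := isConj_iff.1 hc.symm
    have hc : c.1 * h.1 * c.1⁻¹ = transporter e x * t * (transporter e x)⁻¹ :=
      congrArg Subtype.val hc
    have hm : ran (transporter e x)⁻¹ = dom c.1 := by rw [ran_inv, hp1, c.2.1]
    refine ⟨x.1, e.1, ⟨htd, htr'⟩, h.2, (transporter e x)⁻¹ * c.1, ?_, ?_, ?_⟩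
    · rw [dom_mul_of hm, dom_inv, hp2]
    · rw [ran_mul_of hm, c.2.2]
    · rw [mul_inv', inv_inv']
      calc t = ran (transporter e x) * t * ran (transporter e x) := by
            rw [hp2]; conv_rhs => rw [← htd, dom_mul, htd, ← htr', mul_ran]
        _ = (transporter e x)⁻¹ * (transporter e x * t * (transporter e x)⁻¹) *
            transporter e x := by simp only [ran, mul_assoc]
        _ = _ := by rw [← hc]; simp only [mul_assoc]

theorem Conjugate.iso {t h : S} {e : Idem S} (hh : dom h = e.1) (hc : Conjugate t h) :
    ran t = dom t ∧ Iso e.1 (dom t) := by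
  obtain ⟨a, b, ⟨h1, h2⟩, ⟨h3, -⟩, u, hu1, hu2, -⟩ := hc
  exact ⟨h2.trans h1.symm, u⁻¹, by rw [dom_inv, hu2, ← h3, hh], by rw [ran_inv, hu1, h1]⟩

/-- The idempotent `x` is recovered from `t` as its domain, and conjugacy to `h` already forces `dom
t = ran t` to be isomorphic to `e`, so forgetting `x` is a bijection. -/
theorem card_fiber_eq_card_conjugate {e : Idem S} (s : S) (h : MaxSubgroup e) :
    Nat.card {p : Σ x : IsoIdem e, RestrictionFromTo s x x //
        ConjClasses.mk (toMaxSubgroup p.2) = ConjClasses.mk h} =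
      Nat.card {t : S // IsRestriction t s ∧ Conjugate t h.1} := by
  refine Nat.card_congr (Equiv.ofBijective (fun p => ⟨p.1.2.1, p.1.2.2.1,
    (conjugate_iff_isConj_toMaxSubgroup _ _).2 (ConjClasses.mk_eq_mk_iff_isConj.1 p.2)⟩) ⟨?_, ?_⟩)
  · rintro ⟨⟨x, t⟩, hp⟩ ⟨⟨y, u⟩, hq⟩ heq
    have htu : t.1 = u.1 := congrArg Subtype.val heq
    obtain rfl : x = y := Subtype.ext (by rw [← t.2.2.1, ← u.2.2.1, htu])
    obtain rfl : t = u := Subtype.ext htu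
    rfl
  · rintro ⟨t, ht, hc⟩
    obtain ⟨h1, h2⟩ := hc.iso h.2.1
    let x : IsoIdem e := ⟨dom t, isIdempotentElem_dom t, h2⟩
    let r : RestrictionFromTo s x x := ⟨t, ht, rfl, h1⟩
    exact ⟨⟨⟨x, r⟩, ConjClasses.mk_eq_mk_iff_isConj.2
      ((conjugate_iff_isConj_toMaxSubgroup r h).1 hc)⟩, rfl⟩

/-- The number of restrictions of `s` conjugate to an element of the conjugacy class `c`. -/
def conjRestrictionCount {e : Idem S} (s : S) (c : ConjClasses (MaxSubgroup e)) : ℂ :=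
  Nat.card {t : S // IsRestriction t s ∧ Conjugate t (Quotient.out c).1}

theorem card_fiber_eq_conjRestrictionCount {e : Idem S} (s : S) (c : ConjClasses (MaxSubgroup e)) :
    (Nat.card {p : Σ x : IsoIdem e, RestrictionFromTo s x x //
        ConjClasses.mk (toMaxSubgroup p.2) = c} : ℂ) = conjRestrictionCount s c := by
  rw [conjRestrictionCount, ← card_fiber_eq_card_conjugate]
  have : ConjClasses.mk (Quotient.out c) = c := Quotient.out_eq c
  rw [this]

/-- The fiber count depends only on the class of `h`, so the representative picked by `Quotient.out`
is immaterial. -/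
theorem conjRestrictionCount_mk {e : Idem S} (s : S) (h : MaxSubgroup e) :
    conjRestrictionCount s (ConjClasses.mk h) =
      Nat.card {t : S // IsRestriction t s ∧ Conjugate t h.1} := by
  rw [← card_fiber_eq_conjRestrictionCount, card_fiber_eq_card_conjugate]

theorem starChar_eq_mulVec [Finite S] {e : Idem S} [Fintype (ConjClasses (MaxSubgroup e))]
    (χ : IrrChar (MaxSubgroup e)) (s : S) :
    starChar χ s = (groupCharTable (MaxSubgroup e)).mulVec (conjRestrictionCount s) χ := by
  classical
  rw [starChar_eq_sum, ← Fintype.sum_sigma' (f := fun (x : IsoIdem e)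
    (t : RestrictionFromTo s x x) => χ.1 (toMaxSubgroup t)),
    ← Finset.sum_fiberwise_of_maps_to (s := Finset.univ) (t := Finset.univ)
      (g := fun p : Σ x : IsoIdem e, RestrictionFromTo s x x => ConjClasses.mk (toMaxSubgroup p.2))
      (fun _ _ => Finset.mem_univ _)]
  refine Finset.sum_congr rfl fun c _ => ?_
  rw [← card_fiber_eq_conjRestrictionCount, Nat.card_eq_fintype_card, Fintype.card_subtype,
    mul_comm, ← nsmul_eq_mul, ← Finset.sum_const]
  refine Finset.sum_congr rfl fun p hp => ?_
  obtain rfl := (Finset.mem_filter.1 hp).2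
  rfl

end Count

/-! ### Finiteness and the triangular shape -/

section Stability

variable {S : Type*} [InverseSemigroup S]

theorem IsRestriction.dom_restriction {s t : S} (h : IsRestriction s t) :
    IsRestriction (dom s) (dom t) := by
  obtain ⟨f, hf, rfl⟩ := h
  refine ⟨f, hf, ?_⟩
  calc f * t * (f * t)⁻¹ = f * (dom t * f) := by
        rw [mul_inv', inv_of_idem hf]; simp only [dom, mul_assoc]
    _ = f * dom t := by rw [idem_comm (isIdempotentElem_dom t) hf, ← mul_assoc, hf.eq]

/-- In a finite inverse semigroup, an idempotent below `e` and isomorphic to `e` is `e`. -/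
theorem IsRestriction.eq_of_iso [Finite S] {e k : S} (he : IsIdempotentElem e)
    (hk : IsIdempotentElem k) (hr : IsRestriction k e) (hi : Iso e k) : k = e := by
  have hke : k * e = k := by
    have := hr.eq_dom_mul
    rw [dom_of_idem hk] at this
    exact this.symm
  have hek : e * k = k := by rw [idem_comm he hk, hke]
  obtain ⟨u, hu1, hu2⟩ := hi
  have hs2 : u * u⁻¹ = e := hu1
  have hs1 : u⁻¹ * u = k := hu2
  have hu : e * u⁻¹ = u⁻¹ := by
    calc e * u⁻¹ = e * (k * u⁻¹) := by rw [← hs1, inv_mul_inv]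
      _ = u⁻¹ := by rw [← mul_assoc, hek, ← hs1, inv_mul_inv]
  -- Left multiplication by `u⁻¹` on `e S` is injective because `u u⁻¹ = e`, hence surjective by
  -- finiteness. So `e = u⁻¹ y` for some `y`, and `k u⁻¹ = u⁻¹` gives `k e = e`.
  let f : {y : S // e * y = y} → {y : S // e * y = y} := fun y =>
    ⟨u⁻¹ * y.1, by rw [← mul_assoc, hu]⟩
  have hf : Function.Injective f := by
    rintro ⟨y, hy⟩ ⟨z, hz⟩ hyz
    have hyz : u⁻¹ * y = u⁻¹ * z := congrArg Subtype.val hyz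
    apply Subtype.ext
    change y = z
    rw [← hy, ← hz, ← hs2, mul_assoc, hyz, ← mul_assoc]
  obtain ⟨⟨y, hy⟩, hye⟩ := Finite.injective_iff_surjective.1 hf ⟨e, he⟩
  have hye : u⁻¹ * y = e := congrArg Subtype.val hye
  rw [← hke, ← hye, ← mul_assoc, ← hs1, inv_mul_inv]

/-- A restriction of `g ∈ G_e` conjugate to an element of `G_e` is `g` itself. -/
theorem IsRestriction.eq_of_conjugate [Finite S] {e : Idem S} {t : S} {g h : MaxSubgroup e}
    (ht : IsRestriction t g.1) (hc : Conjugate t h.1) : t = g.1 := by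
  have hr := ht.dom_restriction
  rw [g.2.1] at hr
  have hd := hr.eq_of_iso e.2 (isIdempotentElem_dom t) (hc.iso h.2.1).2
  rw [ht.eq_dom_mul, hd]
  exact (congrArg (· * g.1) g.2.1.symm).trans (dom_mul g.1)

theorem conjugate_iff_isConj {e : Idem S} (g h : MaxSubgroup e) :
    Conjugate g.1 h.1 ↔ IsConj g h := by
  constructor
  · rintro ⟨a, b, ⟨ha, -⟩, ⟨hb, -⟩, u, hu1, hu2, hu⟩
    let c : MaxSubgroup e := ⟨u, by rw [hu1, ← ha, g.2.1], by rw [hu2, ← hb, h.2.1]⟩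
    exact (isConj_iff.2 ⟨c, Subtype.ext hu.symm⟩).symm
  · intro hc
    obtain ⟨c, hc⟩ := isConj_iff.1 hc.symm
    exact ⟨e.1, e.1, g.2, h.2, c.1, c.2.1, c.2.2, (congrArg Subtype.val hc).symm⟩

theorem isRestriction_refl (s : S) : IsRestriction s s :=
  ⟨dom s, isIdempotentElem_dom s, (dom_mul s).symm⟩

theorem conjRestrictionCount_self [Finite S] {e : Idem S} (g : MaxSubgroup e) :
    conjRestrictionCount g.1 (ConjClasses.mk g) = 1 := by
  rw [conjRestrictionCount_mk, Nat.cast_eq_one, Nat.card_eq_one_iff_unique]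
  exact ⟨⟨fun a b => Subtype.ext ((a.2.1.eq_of_conjugate a.2.2).trans
    (b.2.1.eq_of_conjugate b.2.2).symm)⟩,
    ⟨⟨g.1, isRestriction_refl _, (conjugate_iff_isConj g g).2 (IsConj.refl g)⟩⟩⟩

theorem conjRestrictionCount_of_ne [Finite S] {e : Idem S} {g h : MaxSubgroup e}
    (hne : ConjClasses.mk h ≠ ConjClasses.mk g) :
    conjRestrictionCount g.1 (ConjClasses.mk h) = 0 := by
  rw [conjRestrictionCount_mk, Nat.cast_eq_zero, Nat.card_eq_zero]
  refine Or.inl ⟨fun t => hne ?_⟩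
  have hc := t.2.2
  rw [t.2.1.eq_of_conjugate t.2.2, conjugate_iff_isConj] at hc
  exact ConjClasses.mk_eq_mk_iff_isConj.2 hc.symm

theorem conjRestrictionCount_of_not_preceq [Finite S] {e f : Idem S} {g : MaxSubgroup f}
    {h : MaxSubgroup e} (hne : ¬ Preceq e.1 f.1) :
    conjRestrictionCount g.1 (ConjClasses.mk h) = 0 := by
  rw [conjRestrictionCount_mk, Nat.cast_eq_zero, Nat.card_eq_zero]
  refine Or.inl ⟨fun t => hne ⟨dom t.1, isIdempotentElem_dom _, (t.2.2.iso h.2.1).2, ?_⟩⟩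
  have := t.2.1.dom_restriction
  rwa [g.2.1] at this

end Stability

/-! ### The factorization and its uniqueness -/

section Main

variable {S : Type*} [InverseSemigroup S] [Finite S] {n : ℕ}

theorem blockCharTable_mul_apply (e : Fin n → Idem S)
    [∀ i, Fintype (ConjClasses (MaxSubgroup (e i)))]
    (A : Matrix (ColIndex e) (ColIndex e) ℂ) (i : Fin n) (χ : IrrChar (MaxSubgroup (e i)))
    (d : ColIndex e) :
    (blockCharTable e * A) ⟨i, χ⟩ d =
      (groupCharTable (MaxSubgroup (e i))).mulVec (fun c => A ⟨i, c⟩ d) χ := by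
  have h : (blockCharTable e * A) ⟨i, χ⟩ d =
      ∑ j, ∑ c, blockCharTable e ⟨i, χ⟩ ⟨j, c⟩ * A ⟨j, c⟩ d := by
    rw [Matrix.mul_apply]
    convert! Fintype.sum_sigma _
  rw [h, Finset.sum_eq_single i]
  · exact Finset.sum_congr rfl fun c _ => by rw [blockCharTable, Matrix.blockDiagonal'_apply_eq]
  · intro j _ hj
    exact Finset.sum_eq_zero fun c _ => by
      rw [blockCharTable, Matrix.blockDiagonal'_apply_ne _ _ _ hj.symm, zero_mul]
  · simp

/-- Both sides of the factorization are group character tables applied to vectors, and these tables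
are injective; so the equation determines every entry of `A`. -/
theorem charTable_eq_iff (e : Fin n → Idem S) (A : Matrix (ColIndex e) (ColIndex e) ℂ) :
    charTable e = blockCharTable e * A ↔
      ∀ i j (c : ConjClasses (MaxSubgroup (e i))) (g : MaxSubgroup (e j)),
        A ⟨i, c⟩ ⟨j, ConjClasses.mk g⟩ = conjRestrictionCount g.1 c := by
  have : ∀ i, Fintype (ConjClasses (MaxSubgroup (e i))) := fun i => Fintype.ofFinite _
  constructor
  · intro hA i j c g
    have h0 : (fun c => A ⟨i, c⟩ ⟨j, ConjClasses.mk g⟩) - conjRestrictionCount g.1 = 0 := by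
      apply eq_zero_of_groupCharTable_mulVec
      funext χ
      rw [Matrix.mulVec_sub, Pi.sub_apply, ← blockCharTable_mul_apply, ← hA,
        ← starChar_eq_mulVec]
      exact sub_self _
    exact sub_eq_zero.1 (congrFun h0 c)
  · intro hA
    ext ⟨i, χ⟩ ⟨j, d⟩
    obtain ⟨g, rfl⟩ := ConjClasses.mk_surjective d
    rw [blockCharTable_mul_apply, funext fun c => hA i j c g, ← starChar_eq_mulVec]
    rfl

/-- Every `χ*` agrees on `g` and `h`, so injectivity of the character table gives equal count
vectors without a bijection between restrictions. This makes the columns of `A` well defined. -/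
theorem conjRestrictionCount_conj {e f : Idem S} {g h : MaxSubgroup f} (hgh : IsConj g h)
    (c : ConjClasses (MaxSubgroup e)) :
    conjRestrictionCount g.1 c = conjRestrictionCount h.1 c := by
  have : Fintype (ConjClasses (MaxSubgroup e)) := Fintype.ofFinite _
  have h0 : (conjRestrictionCount g.1 - conjRestrictionCount h.1 :
      ConjClasses (MaxSubgroup e) → ℂ) = 0 := by
    apply eq_zero_of_groupCharTable_mulVec
    funext χ
    rw [Matrix.mulVec_sub, Pi.sub_apply, ← starChar_eq_mulVec, ← starChar_eq_mulVec,
      starChar_conj χ hgh]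
    exact sub_self _
  exact sub_eq_zero.1 (congrFun h0 c)

end Main

end InverseSemigroup

end

theorem proposition7p1 {S : Type*} [InverseSemigroup S] [Finite S] {n : ℕ}
    (e : Fin n → InverseSemigroup.Idem S) (he : InverseSemigroup.IsTransversal e) :
    (∃! A : Matrix (InverseSemigroup.ColIndex e) (InverseSemigroup.ColIndex e) ℂ,
      InverseSemigroup.charTable e = InverseSemigroup.blockCharTable e * A) ∧
    ∀ A : Matrix (InverseSemigroup.ColIndex e) (InverseSemigroup.ColIndex e) ℂ,
      InverseSemigroup.charTable e = InverseSemigroup.blockCharTable e * A →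
      ((∀ i j, InverseSemigroup.Preceq (e i).1 (e j).1 → i ≤ j) →
        InverseSemigroup.IsBlockUpperUnitriangular e A) ∧
      ∀ (i j : Fin n) (h : InverseSemigroup.MaxSubgroup (e i))
        (g : InverseSemigroup.MaxSubgroup (e j)),
        A ⟨i, ConjClasses.mk h⟩ ⟨j, ConjClasses.mk g⟩ =
          (Nat.card {t : S // InverseSemigroup.IsRestriction t g.1 ∧
            InverseSemigroup.Conjugate t h.1} : ℂ) := by
  simp only [InverseSemigroup.charTable_eq_iff]
  -- The count is taken at a chosen representative of the column's class;
  -- `conjRestrictionCount_conj` transfers it to every `g` in the class.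
  refine ⟨⟨fun c d => InverseSemigroup.conjRestrictionCount (Quotient.out d.2).1 c.2,
    fun i j c g => InverseSemigroup.conjRestrictionCount_conj
      (ConjClasses.mk_eq_mk_iff_isConj.1 (Quotient.out_eq (ConjClasses.mk g))) c, ?_⟩, ?_⟩
  · intro A hA
    ext ⟨i, c⟩ ⟨j, d⟩
    have := hA i j c (Quotient.out d)
    rwa [show ConjClasses.mk (Quotient.out d) = d from Quotient.out_eq d] at this
  · intro A hA
    refine ⟨fun hord => ⟨?_, ?_, ?_⟩, fun i j h g => ?_⟩
    · rintro ⟨i, c⟩ ⟨j, d⟩ hij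
      obtain ⟨h, rfl⟩ := ConjClasses.mk_surjective c
      obtain ⟨g, rfl⟩ := ConjClasses.mk_surjective d
      rw [hA]
      exact InverseSemigroup.conjRestrictionCount_of_not_preceq
        fun hp => absurd (hord i j hp) (not_le.2 hij)
    · intro i c
      obtain ⟨g, rfl⟩ := ConjClasses.mk_surjective c
      rw [hA, InverseSemigroup.conjRestrictionCount_self]
    · intro i c d hcd
      obtain ⟨h, rfl⟩ := ConjClasses.mk_surjective c
      obtain ⟨g, rfl⟩ := ConjClasses.mk_surjective d
      rw [hA, InverseSemigroup.conjRestrictionCount_of_ne hcd]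
    · rw [hA, InverseSemigroup.conjRestrictionCount_mk]
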